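/- Let $\mathsf{CABA}$ be the category of complete atomic Boolean algebras and complete Boolean homomorphisms. Let $\wp:\mathsf{Set}\to\mathsf{CABA}$ be the contravariant powerset functor ($\wp f=f^{-1}$). Let $\mathrm{at}:\mathsf{CABA}\to\mathsf{Set}$ be the contravariant functor that sends a CABA to its set of atoms and a complete homomorphism $h:A\to A'$ to the restriction to atoms of its left adjoint $a'\mapsto\bigwedge\{a\in A\mid a'\le h(a)\}$. Endofunctors $\mathsf L$ on $\mathsf{CABA}$ and $\mathsf T$ on $\mathsf{Set}$ are called Tarski-duals if there are natural isomorphisms $\mathrm{at}\circ\mathsf L\cong\mathsf T\circ\mathrm{at}$ and $\mathsf L\circ\wp\cong\wp\circ\mathsf T$. For each cardinal $\kappa$ fix a set $V_\kappa$ of $\kappa$ variables such that $V_\lambda\subseteq V_\kappa$ whenever $\lambda\le\kappa$, and let $V=\bigcup_\kappa V_\kappa$. Box-free formulae are given by $\pi::=v\mid\top\mid\neg\pi\mid\bigwedge_{i\in I}\pi_i$ with $v\in V$, and one-step formulae (one-step axioms) by $\phi::=\Box\pi\mid\top\mid\neg\phi\mid\bigwedge_{i\in I}\phi_i$ with $\pi$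 box-free, where in both cases $I$ ranges over arbitrary sets. A formula has level $\kappa$ if all its variables are in $V_\kappa$ and all its conjunctions are indexed by sets of cardinality $<\kappa$. For a CABA $A$ let $\mathsf LA$ be the free CABA on the set $\{\Box a\mid a\in A\}$. An assignment $\theta:V\to A$ extends to a map $\hat\theta$ from box-free formulae to $A$ that commutes with $\top$, $\neg$ and $\bigwedge$, and it defines a map $\bar\theta$ from one-step formulae to $\mathsf LA$ by $\bar\theta(\Box\pi)=\Box\hat\theta(\pi)$ and compatibility with $\top$, $\neg$ and $\bigwedge$. It also defines a map $\theta^t$ from one-step formulae to sets of subsets of $A$ by $\theta^t(\Box\pi)=\{W\subseteq A\mid\hat\theta(\pi)\in W\}$, where $\top$ is sent to the set of all subsets of $A$, $\neg$ is interpreted as complement and $\bigwedge$ as intersection. Let $\mathrm{Ax}$ be a class of one-step axioms. A set $W\subseteq A$ is an $\mathrm{Ax}$-subset of $A$ if $W\in\theta^t(\phi)$ for all $\phi\in\mathrm{Ax}$ and all $\theta:V\to A$. The class $\mathrm{Ax}$ is increasing if for every CABA $A$ and every $\theta:V\to A$ the following holds, where $\kappa$ is the cardinality of the powerset of $\mathsf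 LA$: if $\bar\theta(\phi)=1$ for all $\phi\in\mathrm{Ax}$ that have level $\lambda$ for some $\lambda\le\kappa$, then $\bar\theta(\phi)=1$ for all $\phi\in\mathrm{Ax}$. Let $\mathrm{Ax}$ be an increasing class of one-step axioms. Let $\mathsf L_{\mathrm{Ax}}:\mathsf{CABA}\to\mathsf{CABA}$ send $A$ to the quotient of $\mathsf LA$ by the complete congruence generated by the pairs $(\bar\theta(\phi),1)$, for $\phi\in\mathrm{Ax}$ and $\theta:V\to A$, and send $h:A\to A'$ to the complete homomorphism with $\Box a\mapsto\Box h(a)$. Let $\mathsf B_{\mathrm{Ax}}:\mathsf{Set}\to\mathsf{Set}$ send $X$ to the set of $\mathrm{Ax}$-subsets of $\wp X$ and $f:X\to X'$ to the map $W\mapsto\{a'\subseteq X'\mid f^{-1}(a')\in W\}$. Then $\mathsf L_{\mathrm{Ax}}$ and $\mathsf B_{\mathrm{Ax}}$ are Tarski-duals; there is a natural isomorphism $\mathrm{at}\circ\mathsf L_{\mathrm{Ax}}\circ\wp\cong\mathsf B_{\mathrm{Ax}}$; and the category $\mathsf{Alg}(\mathsf L_{\mathrm{Ax}})$ of $\mathsf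 L_{\mathrm{Ax}}$-algebras is dually equivalent to the category $\mathsf{Coalg}(\mathsf B_{\mathrm{Ax}})$ of $\mathsf B_{\mathrm{Ax}}$-coalgebras. -/

import Mathlib

universe u

open CategoryTheory

namespace TarskiDuality

/-! ### Infinitary propositional formulae and one-step formulae -/

/-- A choice of a set `V κ` of `κ` variables for every (small) cardinal `κ`, increasing in `κ`.
The type `carrier` is the class of all variables, that is, the union of all the `V κ`. -/
structure VarSystem where
  carrier : Type (u + 1)
  V : Cardinal.{u} → Set carrier
  card_V : ∀ κ, Cardinal.mk (V κ) = Cardinal.lift.{u + 1} κ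
  mono : ∀ {l κ : Cardinal.{u}}, l ≤ κ → V l ⊆ V κ
  exhaustive : ∀ v, ∃ κ, v ∈ V κ

/-- Such choices exist: take the ordinals below the initial ordinal of `κ`. -/
theorem VarSystem.nonempty : Nonempty VarSystem.{u} :=
  ⟨{ carrier := Ordinal.{u}
     V := fun κ => Set.Iio κ.ord
     card_V := fun κ => by rw [Cardinal.mk_Iio_ordinal, Cardinal.card_ord]
     mono := fun h => Set.Iio_subset_Iio (Cardinal.ord_le_ord.2 h)
     exhaustive := fun v => ⟨Order.succ v.card, Cardinal.lt_ord.2 (Order.lt_succ _)⟩ }⟩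

/-- Box-free infinitary formulae: `π ::= v | ⊤ | ¬ π | ⋀_{i ∈ I} π_i`, for small index sets `I`. -/
inductive BoxFree (V : Type (u + 1)) : Type (u + 1)
  | var (v : V) : BoxFree V
  | top : BoxFree V
  | neg (p : BoxFree V) : BoxFree V
  | conj (I : Type u) (p : I → BoxFree V) : BoxFree V

/-- One-step formulae: `φ ::= □ π | ⊤ | ¬ φ | ⋀_{i ∈ I} φ_i`, with `π` box-free and `I` small. -/
inductive OneStep (V : Type (u + 1)) : Type (u + 1)
  | box (p : BoxFree V) : OneStep V
  | top : OneStep V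
  | neg (f : OneStep V) : OneStep V
  | conj (I : Type u) (f : I → OneStep V) : OneStep V

/-- The formula belongs to the `κ`-th language: its variables are in `V κ` and its conjunctions are
indexed by sets of cardinality `< κ`. -/
def BoxFree.InLevel (S : VarSystem.{u}) (κ : Cardinal.{u}) : BoxFree S.carrier → Prop
  | .var v => v ∈ S.V κ
  | .top => True
  | .neg p => p.InLevel S κ
  | .conj I p => Cardinal.mk I < κ ∧ ∀ i, (p i).InLevel S κ

/-- The one-step formula belongs to the `κ`-th modal language. -/
def OneStep.InLevel (S : VarSystem.{u}) (κ : Cardinal.{u}) : OneStep S.carrier → Prop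
  | .box p => p.InLevel S κ
  | .top => True
  | .neg f => f.InLevel S κ
  | .conj I f => Cardinal.mk I < κ ∧ ∀ i, (f i).InLevel S κ

/-- The value of a box-free formula in a CABA under an assignment. -/
def BoxFree.eval {V : Type (u + 1)} {A : Type u} [CompleteAtomicBooleanAlgebra A] (θ : V → A) :
    BoxFree V → A
  | .var v => θ v
  | .top => ⊤
  | .neg p => (p.eval θ)ᶜ
  | .conj _ p => ⨅ i, (p i).eval θ

/-! ### The category of complete atomic Boolean algebras -/

theorem map_iInf_hom {A B : Type*} [CompleteLattice A] [CompleteLattice B]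
    (h : CompleteLatticeHom A B) {ι : Sort*} (a : ι → A) : h (⨅ i, a i) = ⨅ i, h (a i) :=
  map_iInf h a

theorem map_compl_hom {A B : Type*} [CompleteBooleanAlgebra A] [CompleteBooleanAlgebra B]
    (h : CompleteLatticeHom A B) (a : A) : h aᶜ = (h a)ᶜ :=
  map_compl' h a

/-- Complete atomic Boolean algebras. -/
structure CABA : Type (u + 1) where
  of ::
  carrier : Type u
  [str : CompleteAtomicBooleanAlgebra carrier]

attribute [instance] CABA.str

instance : CoeSort CABA.{u} (Type u) := ⟨CABA.carrier⟩

/-- Complete Boolean homomorphisms: maps that preserve all joins and all meets (hence also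
`⊤`, `⊥` and complements). -/
@[ext]
structure CABA.Hom (A B : CABA.{u}) where
  hom : CompleteLatticeHom A B

instance : Category CABA.{u} where
  Hom := CABA.Hom
  id A := ⟨CompleteLatticeHom.id A⟩
  comp f g := ⟨g.hom.comp f.hom⟩

/-! ### Complete congruences and quotients -/

/-- A complete congruence: an equivalence relation compatible with complements and all meets. -/
structure CompleteCongruence (A : Type u) [CompleteAtomicBooleanAlgebra A] extends Setoid A where
  compl : ∀ {a b : A}, r a b → r aᶜ bᶜ
  iInf : ∀ {I : Type u} {a b : I → A}, (∀ i, r (a i) (b i)) → r (⨅ i, a i) (⨅ i, b i)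

namespace CompleteCongruence

variable {A : Type u} [CompleteAtomicBooleanAlgebra A]

/-- The smallest complete congruence that contains a given relation. -/
def generate (R : A → A → Prop) : CompleteCongruence A where
  r a b := ∀ c : CompleteCongruence A, (∀ x y, R x y → c.r x y) → c.r a b
  iseqv :=
    { refl := fun a c _ => c.iseqv.refl a
      symm := fun h c hc => c.iseqv.symm (h c hc)
      trans := fun h h' c hc => c.iseqv.trans (h c hc) (h' c hc) }
  compl h c hc := c.compl (h c hc)
  iInf h c hc := c.iInf fun i => h i c hc

theorem generate_of {R : A → A → Prop} {a b : A} (h : R a b) : (generate R).r a b :=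
  fun _ hc => hc _ _ h

/-- The kernel of a complete homomorphism. -/
def ker {B : Type u} [CompleteAtomicBooleanAlgebra B] (g : CompleteLatticeHom A B) :
    CompleteCongruence A where
  r a b := g a = g b
  iseqv := ⟨fun _ => rfl, fun h => h.symm, fun h h' => h.trans h'⟩
  compl h := by
    rw [map_compl_hom, map_compl_hom, h]
  iInf h := by
    rw [map_iInf_hom, map_iInf_hom]
    exact iInf_congr h

variable (c : CompleteCongruence A)

theorem inf {a b a' b' : A} (h : c.r a b) (h' : c.r a' b') : c.r (a ⊓ a') (b ⊓ b') := by
  have := c.iInf (I := ULift.{u} Bool) (a := fun i => cond i.down a a')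
    (b := fun i => cond i.down b b') (by rintro ⟨_ | _⟩ <;> assumption)
  have e : ∀ x y : A, (⨅ i : ULift.{u} Bool, cond i.down x y) = x ⊓ y := fun x y => by
    rw [← Equiv.ulift.symm.iInf_comp, iInf_bool_eq]; rfl
  rwa [e, e] at this

theorem sup {a b a' b' : A} (h : c.r a b) (h' : c.r a' b') : c.r (a ⊔ a') (b ⊔ b') := by
  have := c.compl (c.inf (c.compl h) (c.compl h'))
  simpa only [compl_inf, compl_compl] using this

theorem iSup {I : Type u} {a b : I → A} (h : ∀ i, c.r (a i) (b i)) :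
    c.r (⨆ i, a i) (⨆ i, b i) := by
  have := c.compl (c.iInf fun i => c.compl (h i))
  simpa only [compl_iInf, compl_compl] using this

/-- The quotient by a complete congruence. -/
def Quot : Type u := Quotient c.toSetoid

namespace Quot

variable {c}

/-- The class of an element. -/
def mk (a : A) : c.Quot := Quotient.mk c.toSetoid a

theorem mk_eq {a b : A} : (mk a : c.Quot) = mk b ↔ c.r a b := Quotient.eq

theorem mk_surj (x : c.Quot) : ∃ a, mk a = x := Quotient.exists_rep x

/-- A chosen representative. -/
noncomputable def out (x : c.Quot) : A := Quotient.out x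

theorem mk_out (x : c.Quot) : mk x.out = x := Quotient.out_eq x

/-- The meet of classes is the class of the meet. -/
instance : Min c.Quot :=
  ⟨Quotient.map₂ (· ⊓ ·) fun _ _ h _ _ h' => c.inf h h'⟩

instance : Max c.Quot :=
  ⟨Quotient.map₂ (· ⊔ ·) fun _ _ h _ _ h' => c.sup h h'⟩

instance : Compl c.Quot :=
  ⟨Quotient.map (·ᶜ) fun _ _ h => c.compl h⟩

noncomputable instance : InfSet c.Quot := ⟨fun S => mk (⨅ x : S, x.1.out)⟩

noncomputable instance : SupSet c.Quot := ⟨fun S => mk (⨆ x : S, x.1.out)⟩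

instance : Top c.Quot := ⟨mk ⊤⟩

instance : Bot c.Quot := ⟨mk ⊥⟩

theorem mk_inf (a b : A) : (mk (a ⊓ b) : c.Quot) = mk a ⊓ mk b := rfl

theorem mk_sup (a b : A) : (mk (a ⊔ b) : c.Quot) = mk a ⊔ mk b := rfl

theorem mk_compl (a : A) : (mk aᶜ : c.Quot) = (mk a)ᶜ := rfl

instance : PartialOrder c.Quot where
  le x y := x ⊓ y = x
  le_refl x := by
    obtain ⟨a, rfl⟩ := mk_surj x
    rw [← mk_inf, inf_idem]
  le_trans x y z h h' := by
    obtain ⟨a, rfl⟩ := mk_surj x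
    obtain ⟨b, rfl⟩ := mk_surj y
    obtain ⟨d, rfl⟩ := mk_surj z
    change _ ⊓ _ = _ at h h'
    calc mk a ⊓ mk d = mk a ⊓ mk b ⊓ mk d := by rw [h]
      _ = mk a ⊓ (mk b ⊓ mk d) := congrArg mk (inf_assoc a b d)
      _ = mk a := by rw [h', h]
  le_antisymm x y h h' := by
    obtain ⟨a, rfl⟩ := mk_surj x
    obtain ⟨b, rfl⟩ := mk_surj y
    change _ ⊓ _ = _ at h h'
    exact h.symm.trans ((congrArg mk (inf_comm a b)).trans h')

theorem le_def {x y : c.Quot} : x ≤ y ↔ x ⊓ y = x := Iff.rfl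

theorem mk_mono {a b : A} (h : a ≤ b) : (mk a : c.Quot) ≤ mk b := by
  rw [le_def, ← mk_inf, inf_eq_left.2 h]

theorem mk_le {a b : A} (h : (mk a : c.Quot) ≤ mk b) : ∃ b', b ≤ b' ∧ a ≤ b' ∧ c.r b' b := by
  refine ⟨a ⊔ b, le_sup_right, le_sup_left, ?_⟩
  have h1 : c.r (a ⊓ b) a := mk_eq.1 h
  have h2 := c.sup h1 (c.iseqv.refl b)
  rw [sup_eq_right.2 (inf_le_right : a ⊓ b ≤ b)] at h2
  exact c.iseqv.symm h2

theorem out_rel {a : A} {x : c.Quot} (h : mk a = x) : c.r x.out a :=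
  mk_eq.1 ((mk_out x).trans h.symm)

noncomputable instance : CompleteLattice c.Quot where
  __ := (inferInstance : PartialOrder c.Quot)
  sup := (· ⊔ ·)
  le_sup_left x y := by
    obtain ⟨a, rfl⟩ := mk_surj x
    obtain ⟨b, rfl⟩ := mk_surj y
    exact mk_mono le_sup_left
  le_sup_right x y := by
    obtain ⟨a, rfl⟩ := mk_surj x
    obtain ⟨b, rfl⟩ := mk_surj y
    exact mk_mono le_sup_right
  sup_le x y z h h' := by
    obtain ⟨a, rfl⟩ := mk_surj x
    obtain ⟨b, rfl⟩ := mk_surj y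
    obtain ⟨d, rfl⟩ := mk_surj z
    change _ ⊓ _ = _ at h h'
    change (mk a ⊔ mk b) ⊓ mk d = _
    rw [← mk_sup, ← mk_inf, inf_sup_right, mk_sup, mk_inf, mk_inf, h, h', mk_sup]
  inf := (· ⊓ ·)
  inf_le_left x y := by
    obtain ⟨a, rfl⟩ := mk_surj x
    obtain ⟨b, rfl⟩ := mk_surj y
    exact mk_mono inf_le_left
  inf_le_right x y := by
    obtain ⟨a, rfl⟩ := mk_surj x
    obtain ⟨b, rfl⟩ := mk_surj y
    exact mk_mono inf_le_right
  le_inf x y z h h' := by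
    obtain ⟨a, rfl⟩ := mk_surj x
    obtain ⟨b, rfl⟩ := mk_surj y
    obtain ⟨d, rfl⟩ := mk_surj z
    change _ ⊓ _ = _ at h h'
    change mk a ⊓ (mk b ⊓ mk d) = _
    rw [← mk_inf, ← mk_inf, ← inf_assoc, mk_inf, mk_inf, h, h']
  isLUB_sSup S := by
    constructor
    · intro x hx
      have h1 : x = mk x.out := (mk_out x).symm
      rw [h1]
      exact mk_mono (le_iSup (fun x : S => x.1.out) ⟨x, hx⟩)
    · intro y hy
      obtain ⟨b, rfl⟩ := mk_surj y
      change mk (⨆ x : S, x.1.out) ⊓ mk b = mk (⨆ x : S, x.1.out)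
      rw [← mk_inf, iSup_inf_eq]
      refine mk_eq.2 (c.iSup fun x => mk_eq.1 ?_)
      rw [mk_inf, mk_out]
      exact hy x.2
  isGLB_sInf S := by
    constructor
    · intro x hx
      have h1 : x = mk x.out := (mk_out x).symm
      rw [h1]
      exact mk_mono (iInf_le (fun x : S => x.1.out) ⟨x, hx⟩)
    · intro y hy
      obtain ⟨b, rfl⟩ := mk_surj y
      have h1 : ∀ x : S, c.r (b ⊔ x.1.out) x.1.out := fun x => by
        obtain ⟨b', h1, h2, h3⟩ := mk_le (c := c) (a := b) (b := x.1.out)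
          (by rw [mk_out]; exact hy x.2)
        have h4 := c.sup (c.iseqv.refl b) h3
        rw [sup_eq_right.2 h2] at h4
        exact c.iseqv.trans (c.iseqv.symm h4) h3
      have h2 : (mk (⨅ x : S, (b ⊔ x.1.out)) : c.Quot) = mk (⨅ x : S, x.1.out) :=
        mk_eq.2 (c.iInf h1)
      change mk b ≤ mk (⨅ x : S, x.1.out)
      rw [← h2]
      exact mk_mono (le_iInf fun x => le_sup_left)
  top := ⊤
  le_top x := by
    obtain ⟨a, rfl⟩ := mk_surj x
    exact mk_mono le_top
  bot := ⊥
  bot_le x := by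
    obtain ⟨a, rfl⟩ := mk_surj x
    exact mk_mono bot_le

theorem mk_iInf {I : Type u} (a : I → A) : (mk (⨅ i, a i) : c.Quot) = ⨅ i, mk (a i) := by
  apply le_antisymm
  · exact le_iInf fun i => mk_mono (iInf_le a i)
  · have h1 : (mk (⨅ i, a i) : c.Quot) =
        mk (⨅ x : Set.range fun i => (mk (a i) : c.Quot), x.1.out) := by
      have h3 := iInf_range' (g := fun x : c.Quot => x.out) (fun i => (mk (a i) : c.Quot))
      rw [h3]
      exact mk_eq.2 (c.iInf fun i => c.iseqv.symm (out_rel rfl))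
    rw [h1]
    exact le_rfl

theorem mk_iSup {I : Type u} (a : I → A) : (mk (⨆ i, a i) : c.Quot) = ⨆ i, mk (a i) := by
  apply le_antisymm
  · have h1 : (mk (⨆ i, a i) : c.Quot) =
        mk (⨆ x : Set.range fun i => (mk (a i) : c.Quot), x.1.out) := by
      have h3 := iSup_range' (g := fun x : c.Quot => x.out) (fun i => (mk (a i) : c.Quot))
      rw [h3]
      exact mk_eq.2 (c.iSup fun i => c.iseqv.symm (out_rel rfl))
    rw [h1]
    exact le_rfl
  · exact iSup_le fun i => mk_mono (le_iSup a i)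

noncomputable instance : CompleteBooleanAlgebra c.Quot where
  __ := (inferInstance : CompleteLattice c.Quot)
  compl x := xᶜ
  le_sup_inf x y z := by
    obtain ⟨a, rfl⟩ := mk_surj x
    obtain ⟨b, rfl⟩ := mk_surj y
    obtain ⟨d, rfl⟩ := mk_surj z
    change (mk ((a ⊔ b) ⊓ (a ⊔ d)) : c.Quot) ≤ mk (a ⊔ b ⊓ d)
    exact mk_mono le_sup_inf
  inf_compl_le_bot x := by
    obtain ⟨a, rfl⟩ := mk_surj x
    change (mk (a ⊓ aᶜ) : c.Quot) ≤ mk ⊥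
    exact mk_mono (by simp)
  top_le_sup_compl x := by
    obtain ⟨a, rfl⟩ := mk_surj x
    change (mk ⊤ : c.Quot) ≤ mk (a ⊔ aᶜ)
    exact mk_mono (by simp)

noncomputable instance : CompleteAtomicBooleanAlgebra c.Quot where
  __ := (inferInstance : CompleteBooleanAlgebra c.Quot)
  iInf_iSup_eq {ι κ} f := by
    have h : f = fun i k => (mk (f i k).out : c.Quot) := by
      funext i k; exact (mk_out _).symm
    rw [h]
    have h1 : (⨅ i, ⨆ k, (mk (f i k).out : c.Quot)) = mk (⨅ i, ⨆ k, (f i k).out) := by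
      rw [mk_iInf]; exact iInf_congr fun i => (mk_iSup _).symm
    have h2 : (⨆ g : ∀ i, κ i, ⨅ i, (mk (f i (g i)).out : c.Quot)) =
        mk (⨆ g : ∀ i, κ i, ⨅ i, (f i (g i)).out) := by
      rw [mk_iSup]; exact iSup_congr fun g => (mk_iInf _).symm
    change (⨅ i, ⨆ k, (mk (f i k).out : c.Quot)) =
      ⨆ g : ∀ i, κ i, ⨅ i, (mk (f i (g i)).out : c.Quot)
    rw [h1, h2, iInf_iSup_eq]

end Quot

/-- The quotient map, a complete homomorphism. -/
noncomputable def proj : CompleteLatticeHom A c.Quot where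
  toFun := Quot.mk
  map_sInf' S := by rw [sInf_eq_iInf', Quot.mk_iInf, sInf_image']
  map_sSup' S := by rw [sSup_eq_iSup', Quot.mk_iSup, sSup_image']

theorem proj_surjective : Function.Surjective c.proj := Quot.mk_surj

theorem proj_eq {a b : A} : c.proj a = c.proj b ↔ c.r a b := Quot.mk_eq

/-- A complete homomorphism whose kernel contains `c` factors through the quotient. -/
noncomputable def lift {B : Type u} [CompleteAtomicBooleanAlgebra B] (g : CompleteLatticeHom A B)
    (h : ∀ a b, c.r a b → g a = g b) : CompleteLatticeHom c.Quot B :=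
  let F : c.Quot → B := Quotient.lift g h
  have key : ∀ x : c.Quot, F x = g x.out := fun x => by
    conv_lhs => rw [← Quot.mk_out x]
    rfl
  { toFun := F
    map_sInf' := fun S => by
      change g (⨅ x : S, x.1.out) = _
      rw [map_iInf_hom, sInf_image']
      exact iInf_congr fun x => (key _).symm
    map_sSup' := fun S => by
      change g (⨆ x : S, x.1.out) = _
      rw [map_iSup, sSup_image']
      exact iSup_congr fun x => (key _).symm }

theorem lift_proj {B : Type u} [CompleteAtomicBooleanAlgebra B] (g : CompleteLatticeHom A B)
    (h : ∀ a b, c.r a b → g a = g b) (a : A) : c.lift g h (c.proj a) = g a := rfl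

end CompleteCongruence

/-! ### Free complete atomic Boolean algebras -/

/-- The free CABA on a set `X`, realised as the double powerset of `X`; its universal property is
`FreeCABA.existsUnique_lift` below. -/
def FreeCABA (X : Type u) : Type u := Set (Set X)

namespace FreeCABA

instance (X : Type u) : CompleteAtomicBooleanAlgebra (FreeCABA X) :=
  inferInstanceAs (CompleteAtomicBooleanAlgebra (Set (Set X)))

/-- The free generator `□ x`. -/
def gen {X : Type u} (x : X) : FreeCABA X := {W : Set X | x ∈ W}

variable {X : Type u} {B : Type u} [CompleteAtomicBooleanAlgebra B]

/-- The complete homomorphism determined by its values on the generators. -/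
def lift (f : X → B) : CompleteLatticeHom (FreeCABA X) B :=
  (CompleteLatticeHom.OrderIso.toCompleteLatticeHom
      (CompleteAtomicBooleanAlgebra.toSetOfIsAtom (α := B)).symm).comp
    (CompleteLatticeHom.setPreimage
      (fun b : {b : B // IsAtom b} => ({x | b.1 ≤ f x} : Set X)))

theorem lift_gen (f : X → B) (x : X) : lift f (gen x) = f x :=
  (CompleteAtomicBooleanAlgebra.toSetOfIsAtom (α := B)).symm_apply_apply (f x)

theorem eq_iSup_iInf (S : FreeCABA X) :
    S = ⨆ W : {W : Set X // W ∈ (show Set (Set X) from S)},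
      ⨅ x : X, ⨅ s : {s : FreeCABA X // (x ∈ W.1 ∧ s = gen x) ∨ (x ∉ W.1 ∧ s = (gen x)ᶜ)}, s.1 := by
  have key : ∀ W W' : Set X, (W' ∈ (show Set (Set X) from ⨅ x : X,
      ⨅ s : {s : FreeCABA X // (x ∈ W ∧ s = gen x) ∨ (x ∉ W ∧ s = (gen x)ᶜ)}, s.1)) ↔ W' = W := by
    intro W W'
    refine (Set.mem_iInter).trans ?_
    constructor
    · intro h
      ext x
      have hx := Set.mem_iInter.1 (h x)
      by_cases hW : x ∈ W
      · exact iff_of_true (hx ⟨gen x, .inl ⟨hW, rfl⟩⟩) hW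
      · exact iff_of_false (hx ⟨(gen x)ᶜ, .inr ⟨hW, rfl⟩⟩) hW
    · rintro rfl x
      refine Set.mem_iInter.2 ?_
      rintro ⟨s, ⟨h, rfl⟩ | ⟨h, rfl⟩⟩
      · exact h
      · exact h
  refine Set.ext fun W' => ?_
  refine Iff.trans ?_ (Set.mem_iUnion).symm
  constructor
  · intro h
    exact ⟨⟨W', h⟩, (key _ _).2 rfl⟩
  · rintro ⟨W, hW⟩
    rw [(key _ _).1 hW]
    exact W.2

theorem hom_ext {g h : CompleteLatticeHom (FreeCABA X) B} (H : ∀ x, g (gen x) = h (gen x)) :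
    g = h := by
  refine DFunLike.ext _ _ fun S => ?_
  rw [eq_iSup_iInf S, map_iSup, map_iSup]
  refine iSup_congr fun W => ?_
  rw [map_iInf_hom, map_iInf_hom]
  refine iInf_congr fun x => ?_
  rw [map_iInf_hom, map_iInf_hom]
  refine iInf_congr ?_
  rintro ⟨s, ⟨-, rfl⟩ | ⟨-, rfl⟩⟩
  · exact H x
  · change g (gen x)ᶜ = h (gen x)ᶜ
    rw [map_compl_hom, map_compl_hom, H x]

/-- The universal property of the free CABA on `X`. -/
theorem existsUnique_lift (f : X → B) :
    ∃! g : CompleteLatticeHom (FreeCABA X) B, ∀ x, g (gen x) = f x :=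
  ⟨lift f, lift_gen f, fun _ h => hom_ext fun x => (h x).trans (lift_gen f x).symm⟩

end FreeCABA

/-! ### Semantics of one-step formulae -/

/-- The value of a one-step formula in the free CABA on `A`, for an assignment `θ` in a
CABA `A`. -/
def OneStep.eval {V : Type (u + 1)} {A : Type u} [CompleteAtomicBooleanAlgebra A] (θ : V → A) :
    OneStep V → FreeCABA A
  | .box p => FreeCABA.gen (p.eval θ)
  | .top => ⊤
  | .neg f => (f.eval θ)ᶜ
  | .conj _ f => ⨅ i, (f i).eval θ

/-- The set of subsets of `A` assigned to a one-step formula. -/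
def OneStep.subsets {V : Type (u + 1)} {A : Type u} [CompleteAtomicBooleanAlgebra A] (θ : V → A) :
    OneStep V → Set (Set A)
  | .box p => {W | p.eval θ ∈ W}
  | .top => Set.univ
  | .neg f => (f.subsets θ)ᶜ
  | .conj _ f => ⋂ i, (f i).subsets θ

/-- `W` is an `Ax`-subset of `A`. -/
def IsAxSubset {V : Type (u + 1)} (Ax : Set (OneStep V)) {A : Type u}
    [CompleteAtomicBooleanAlgebra A] (W : Set A) : Prop :=
  ∀ f ∈ Ax, ∀ θ : V → A, W ∈ f.subsets θ

/-- The axioms in `Ax` that belong to the language of some level `l ≤ κ`. -/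
def axiomsUpTo (S : VarSystem.{u}) (Ax : Set (OneStep S.carrier)) (κ : Cardinal.{u}) :
    Set (OneStep S.carrier) :=
  {f | f ∈ Ax ∧ ∃ l ≤ κ, f.InLevel S l}

/-- A class of one-step axioms is increasing if, for all CABAs `A` and assignments `θ` in `A`, its
axioms all have value `⊤` in the free CABA `L A` on `A` as soon as this is so for its axioms of
level at most the cardinality of the powerset of `L A`. -/
def IsIncreasing (S : VarSystem.{u}) (Ax : Set (OneStep S.carrier)) : Prop :=
  ∀ (A : CABA.{u}) (θ : S.carrier → A),
    (∀ f ∈ axiomsUpTo S Ax (Cardinal.mk (Set (FreeCABA A))), f.eval θ = ⊤) →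
      ∀ f ∈ Ax, f.eval θ = ⊤

section Naturality

variable {V : Type (u + 1)} {A B : Type u} [CompleteAtomicBooleanAlgebra A]
  [CompleteAtomicBooleanAlgebra B] (h : CompleteLatticeHom A B) (θ : V → A)

theorem BoxFree.eval_comp (p : BoxFree V) : p.eval (h ∘ θ) = h (p.eval θ) := by
  induction p with
  | var v => rfl
  | top => exact (map_top h).symm
  | neg p ih => simp only [BoxFree.eval, ih, map_compl_hom]
  | conj I p ih => simp only [BoxFree.eval, ih, map_iInf_hom]

theorem OneStep.eval_comp (f : OneStep V) :
    f.eval (h ∘ θ) = FreeCABA.lift (fun a => FreeCABA.gen (h a)) (f.eval θ) := by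
  induction f with
  | box p => simp only [OneStep.eval, BoxFree.eval_comp, FreeCABA.lift_gen]
  | top => exact (map_top _).symm
  | neg p ih => simp only [OneStep.eval, ih, map_compl_hom]
  | conj I p ih => simp only [OneStep.eval, ih, map_iInf_hom]

theorem OneStep.mem_subsets_comp (f : OneStep V) (W : Set B) :
    W ∈ f.subsets (h ∘ θ) ↔ h ⁻¹' W ∈ f.subsets θ := by
  induction f with
  | box p => simp only [OneStep.subsets, BoxFree.eval_comp]; rfl
  | top => exact Iff.rfl
  | neg p ih => exact not_congr ih
  | conj I p ih => simp only [OneStep.subsets, Set.mem_iInter, ih]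

theorem IsAxSubset.preimage {Ax : Set (OneStep V)} {W : Set B} (hW : IsAxSubset Ax W) :
    IsAxSubset Ax (h ⁻¹' W) :=
  fun f hf θ => (f.mem_subsets_comp h θ W).1 (hW f hf _)

end Naturality

/-! ### The two endofunctors -/

section Functors

variable {V : Type (u + 1)} (Ax : Set (OneStep V))

/-- The complete congruence on the free CABA on `A` generated by the pairs
`(value of f under θ, ⊤)`, for all `f ∈ Ax` and all assignments `θ` in `A`. -/
def axCongruence (A : Type u) [CompleteAtomicBooleanAlgebra A] :
    CompleteCongruence (FreeCABA A) :=
  CompleteCongruence.generate fun x y => (∃ f ∈ Ax, ∃ θ : V → A, x = f.eval θ) ∧ y = ⊤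

/-- The class of the generator `□ a`. -/
noncomputable def boxAx {A : Type u} [CompleteAtomicBooleanAlgebra A] (a : A) :
    (axCongruence Ax A).Quot :=
  (axCongruence Ax A).proj (FreeCABA.gen a)

theorem hom_ext_boxAx {A B : Type u} [CompleteAtomicBooleanAlgebra A]
    [CompleteAtomicBooleanAlgebra B] {g h : CompleteLatticeHom (axCongruence Ax A).Quot B}
    (H : ∀ a, g (boxAx Ax a) = h (boxAx Ax a)) : g = h := by
  have key : g.comp (axCongruence Ax A).proj = h.comp (axCongruence Ax A).proj :=
    FreeCABA.hom_ext H
  refine DFunLike.ext _ _ fun x => ?_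
  obtain ⟨s, rfl⟩ := (axCongruence Ax A).proj_surjective x
  exact DFunLike.congr_fun key s

/-- The complete homomorphism that sends the class of `□ a` to the class of `□ (h a)`. -/
noncomputable def mapAx {A B : Type u} [CompleteAtomicBooleanAlgebra A]
    [CompleteAtomicBooleanAlgebra B] (h : CompleteLatticeHom A B) :
    CompleteLatticeHom (axCongruence Ax A).Quot (axCongruence Ax B).Quot :=
  (axCongruence Ax A).lift
    ((axCongruence Ax B).proj.comp (FreeCABA.lift fun a => FreeCABA.gen (h a)))
    (by
      intro x y hxy
      refine hxy (CompleteCongruence.ker _) ?_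
      rintro x y ⟨⟨f, hf, θ, rfl⟩, rfl⟩
      change (axCongruence Ax B).proj (FreeCABA.lift (fun a => FreeCABA.gen (h a)) (f.eval θ)) =
        (axCongruence Ax B).proj (FreeCABA.lift (fun a => FreeCABA.gen (h a)) ⊤)
      rw [map_top, ← OneStep.eval_comp, CompleteCongruence.proj_eq]
      exact CompleteCongruence.generate_of ⟨⟨f, hf, h ∘ θ, rfl⟩, rfl⟩)

theorem mapAx_boxAx {A B : Type u} [CompleteAtomicBooleanAlgebra A]
    [CompleteAtomicBooleanAlgebra B] (h : CompleteLatticeHom A B) (a : A) :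
    mapAx Ax h (boxAx Ax a) = boxAx Ax (h a) := by
  change (axCongruence Ax B).proj (FreeCABA.lift _ (FreeCABA.gen a)) = _
  rw [FreeCABA.lift_gen]
  rfl

/-- The endofunctor `L_Ax` on CABAs: `A` is sent to the free CABA on `{□ a : a ∈ A}` modulo the
complete congruence generated by `Ax`, and `h` to the homomorphism with `□ a ↦ □ (h a)`. -/
noncomputable def LAx : CABA.{u} ⥤ CABA.{u} where
  obj A := CABA.of (axCongruence Ax A).Quot
  map h := ⟨mapAx Ax h.hom⟩
  map_id _ := CABA.Hom.ext (hom_ext_boxAx Ax fun a => mapAx_boxAx Ax _ a)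
  map_comp f g := CABA.Hom.ext (hom_ext_boxAx Ax fun a =>
    (mapAx_boxAx Ax _ a).trans
      ((congrArg (mapAx Ax g.hom) (mapAx_boxAx Ax f.hom a)).trans (mapAx_boxAx Ax _ _)).symm)

/-- The endofunctor `B_Ax` on sets: `X` is sent to the set of `Ax`-subsets of the powerset of `X`,
and `f : X → Y` to the map `W ↦ {b ⊆ Y | f⁻¹(b) ∈ W}`. -/
def BAx : Type u ⥤ Type u where
  obj X := {W : Set (Set X) // IsAxSubset Ax W}
  map {_ Y} f := TypeCat.ofHom fun W =>
    ⟨{b : Set Y | f ⁻¹' b ∈ W.1}, W.2.preimage (CompleteLatticeHom.setPreimage f)⟩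
  map_id _ := rfl
  map_comp _ _ := rfl

end Functors

/-! ### Tarski duality of functors -/

section LeftAdjoint

variable {A B : Type u} [CompleteAtomicBooleanAlgebra A] [CompleteAtomicBooleanAlgebra B]
  (h : CompleteLatticeHom A B)

/-- The left adjoint of a complete homomorphism. -/
def leftAdj (b : B) : A := sInf {a | b ≤ h a}

theorem leftAdj_le_iff (b : B) (a : A) : leftAdj h b ≤ a ↔ b ≤ h a := by
  constructor
  · intro H
    refine le_trans ?_ (OrderHomClass.mono h H)
    rw [leftAdj, map_sInf]
    refine le_sInf ?_
    rintro _ ⟨x, hx, rfl⟩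
    exact hx
  · exact fun H => sInf_le H

theorem isAtom_leftAdj {b : B} (hb : IsAtom b) : IsAtom (leftAdj h b) := by
  constructor
  · intro H
    have := (leftAdj_le_iff h b ⊥).1 H.le
    rw [map_bot] at this
    exact hb.1 (le_bot_iff.1 this)
  · intro x hx
    have h1 : ¬ b ≤ h x := fun H => hx.not_ge ((leftAdj_le_iff h b x).2 H)
    have h2 : b ≤ h xᶜ := by
      rw [map_compl_hom, le_compl_iff_disjoint_right]
      exact disjoint_iff.2 (hb.2 _ (lt_of_le_of_ne inf_le_left fun e => h1 (inf_eq_left.1 e)))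
    have h3 : x ≤ xᶜ := hx.le.trans ((leftAdj_le_iff h b _).2 h2)
    exact le_compl_self.1 h3

end LeftAdjoint

/-- The contravariant functor sending a CABA to its set of atoms, and a complete homomorphism to
the restriction to atoms of its left adjoint. -/
def atomsFunctor : CABA.{u} ⥤ (Type u)ᵒᵖ where
  obj A := Opposite.op {a : A // IsAtom a}
  map {A B} h := (TypeCat.ofHom fun b : {b : B // IsAtom b} =>
    (⟨leftAdj h.hom b.1, isAtom_leftAdj h.hom b.2⟩ : {a : A // IsAtom a})).op
  map_id A := by
    refine Quiver.Hom.unop_inj ?_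
    refine ConcreteCategory.hom_ext _ _ fun b : {a : A // IsAtom a} => ?_
    exact Subtype.ext (eq_of_forall_ge_iff fun a => leftAdj_le_iff (CompleteLatticeHom.id A) b.1 a)
  map_comp {A B C} f g := by
    refine Quiver.Hom.unop_inj ?_
    refine ConcreteCategory.hom_ext _ _ fun b : {a : C // IsAtom a} => ?_
    refine Subtype.ext (eq_of_forall_ge_iff fun a => ?_)
    exact (leftAdj_le_iff (g.hom.comp f.hom) b.1 a).trans
      ((leftAdj_le_iff f.hom (leftAdj g.hom b.1) a).trans
        (leftAdj_le_iff g.hom b.1 (f.hom a))).symm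

/-- The contravariant functor sending a set to its powerset, and a function to its inverse
image. -/
def powersetFunctor : (Type u)ᵒᵖ ⥤ CABA.{u} where
  obj X := CABA.of (Set X.unop)
  map f := ⟨CompleteLatticeHom.setPreimage f.unop⟩
  map_id _ := rfl
  map_comp _ _ := rfl

/-- `L` and `T` are Tarski-duals: both squares formed with the contravariant functors of Tarski
duality commute up to natural isomorphism. -/
def TarskiDuals (L : CABA.{u} ⥤ CABA.{u}) (T : Type u ⥤ Type u) : Prop :=
  Nonempty (L ⋙ atomsFunctor ≅ atomsFunctor ⋙ T.op) ∧
    Nonempty (powersetFunctor ⋙ L ≅ T.op ⋙ powersetFunctor)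

end TarskiDuality

namespace TarskiDuality

/-! ### Tarski duality -/

/-! The free CABA on `A` is the powerset of the powerset of `A`, with `□ a` the family of all `W`
containing `a`. Under this identification the value of a one-step formula under `θ` is the family of
subsets of `A` that `θ` assigns to the formula (`OneStep.eval_eq_subsets`). Forcing these families
to equal `⊤` amounts, for a complete congruence, to forcing their intersection to equal `⊤`, and
that intersection is the family `E` of all `Ax`-subsets of `A`. The generated congruence therefore
relates two families exactly when they agree on `E` (`axCongruence_iff`), so the quotient is the
powerset of `E` (`quotOrderIso`).

For `A = ℘ X` this gives `L_Ax ∘ ℘ ≅ ℘ ∘ B_Ax` (`powersetLAxIso`). Everything else is formal from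
Tarski duality: composing with `at` gives the other two natural isomorphisms, and any dual
equivalence that matches two endofunctors turns coalgebras into algebras (`algebraOpEquiv`). -/

/-- An order isomorphism between CABAs is an isomorphism in the category of CABAs. -/
def CABA.isoOfOrderIso {A B : CABA.{u}} (e : A ≃o B) : A ≅ B where
  hom := ⟨CompleteLatticeHom.OrderIso.toCompleteLatticeHom e⟩
  inv := ⟨CompleteLatticeHom.OrderIso.toCompleteLatticeHom e.symm⟩
  hom_inv_id := CABA.Hom.ext (DFunLike.ext _ _ fun a => e.symm_apply_apply a)
  inv_hom_id := CABA.Hom.ext (DFunLike.ext _ _ fun b => e.apply_symm_apply b)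

/-- A CABA is naturally isomorphic to the powerset of its set of atoms. -/
def atomsPowersetIso : atomsFunctor.{u} ⋙ powersetFunctor ≅ 𝟭 CABA.{u} :=
  (NatIso.ofComponents (F := 𝟭 CABA.{u}) (G := atomsFunctor ⋙ powersetFunctor)
    (fun A => CABA.isoOfOrderIso (B := CABA.of (Set {a : A // IsAtom a}))
      CompleteAtomicBooleanAlgebra.toSetOfIsAtom)
    -- Naturality is the adjunction: `b ≤ h a` iff the left adjoint of `h` sends the atom `b` below
    -- `a`.
    (fun {_ B} h => CABA.Hom.ext (DFunLike.ext _ _ fun a =>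
      Set.ext fun b : {b : B // IsAtom b} => (leftAdj_le_iff h.hom b.1 a).symm))).symm

/-- The left adjoint of inverse image is direct image; here only its effect on atoms is needed, for
the naturality of `powersetAtomsIso`. -/
theorem leftAdj_setPreimage_singleton {X Y : Type u} (f : X → Y) (x : X) :
    leftAdj (CompleteLatticeHom.setPreimage f) {x} = {f x} :=
  eq_of_forall_ge_iff fun s => (leftAdj_le_iff _ _ _).trans <| by
    exact Set.singleton_subset_iff.trans (Set.singleton_subset_iff (s := s)).symm

/-- The points of a set are the atoms of its powerset. -/
noncomputable def equivAtoms (X : Type u) : X ≃ {a : Set X // IsAtom a} :=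
  Equiv.ofBijective (fun x => ⟨{x}, Set.isAtom_singleton x⟩)
    ⟨fun _ _ h => Set.singleton_injective (congrArg Subtype.val h), fun a => by
      obtain ⟨x, hx⟩ := Set.isAtom_iff.1 a.2
      exact ⟨x, Subtype.ext hx.symm⟩⟩

/-- A set is naturally isomorphic to the set of atoms of its powerset. -/
noncomputable def powersetAtomsIso : powersetFunctor.{u} ⋙ atomsFunctor ≅ 𝟭 (Type u)ᵒᵖ :=
  NatIso.ofComponents
    (fun X => (equivAtoms X.unop).toIso.op)
    (fun {_ Y} f => Quiver.Hom.unop_inj (ConcreteCategory.hom_ext _ _ fun y : Y.unop =>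
      Subtype.ext (leftAdj_setPreimage_singleton f.unop y)))

/-- Tarski duality: taking atoms and taking powersets are mutually inverse up to isomorphism. -/
noncomputable def tarskiDuality : CABA.{u} ≌ (Type u)ᵒᵖ :=
  CategoryTheory.Equivalence.mk atomsFunctor powersetFunctor atomsPowersetIso.symm powersetAtomsIso

instance : powersetFunctor.{u}.IsEquivalence :=
  inferInstanceAs tarskiDuality.{u}.inverse.IsEquivalence

/-! ### The quotient of the free CABA by the axioms -/

section Quotient

variable {V : Type (u + 1)} (Ax : Set (OneStep V)) (A : Type u) [CompleteAtomicBooleanAlgebra A]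

/-- Both recursions have the same clauses once the free CABA is read as a double powerset. This
turns membership in the value of an axiom into the condition defining `Ax`-subsets. -/
theorem OneStep.eval_eq_subsets (θ : V → A) (f : OneStep V) :
    (show Set (Set A) from f.eval θ) = f.subsets θ := by
  induction f with
  | box p => rfl
  | top => rfl
  | neg p ih => exact congrArg compl ih
  | conj I p ih => exact iInf_congr ih

/-- The restriction of a family of subsets of `A` to the `Ax`-subsets. -/
def restrictAx : CompleteLatticeHom (FreeCABA A) (Set {W : Set A // IsAxSubset Ax W}) :=
  CompleteLatticeHom.setPreimage Subtype.val

/-- The family of all `Ax`-subsets of `A`. -/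
def axSubsets : FreeCABA A := {W : Set A | IsAxSubset Ax W}

/-- `axSubsets` is the meet of all values of axioms, each congruent to `⊤`, and a complete
congruence respects meets. -/
theorem axCongruence_axSubsets : (axCongruence Ax A).r (axSubsets Ax A) ⊤ := by
  -- The meet runs over values rather than over pairs `(f, θ)`: the pairs live in a larger universe,
  -- while the values form a small subset of the free CABA, as `CompleteCongruence.iInf` requires.
  have key : axSubsets Ax A =
      ⨅ x : {x : FreeCABA A // ∃ f ∈ Ax, ∃ θ : V → A, x = f.eval θ}, x.1 := by
    refine Set.ext fun W => Iff.trans ?_ Set.mem_iInter.symm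
    constructor
    · rintro hW ⟨_, f, hf, θ, rfl⟩
      exact (Set.ext_iff.1 (f.eval_eq_subsets A θ) W).2 (hW f hf θ)
    · intro hW f hf θ
      exact (Set.ext_iff.1 (f.eval_eq_subsets A θ) W).1 (hW ⟨_, f, hf, θ, rfl⟩)
  have h := (axCongruence Ax A).iInf
    (a := fun x : {x : FreeCABA A // ∃ f ∈ Ax, ∃ θ : V → A, x = f.eval θ} => x.1)
    (b := fun _ => ⊤) fun x => CompleteCongruence.generate_of ⟨x.2, rfl⟩
  rwa [iInf_top, ← key] at h

/-- The generated complete congruence identifies the families with the same `Ax`-subsets. -/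
theorem axCongruence_iff (S T : FreeCABA A) :
    (axCongruence Ax A).r S T ↔ restrictAx Ax A S = restrictAx Ax A T := by
  constructor
  · intro h
    -- The generated congruence is the least one, so it suffices that the kernel of restriction
    -- contains the generating pairs.
    refine h (CompleteCongruence.ker (restrictAx Ax A)) ?_
    rintro _ _ ⟨⟨f, hf, θ, rfl⟩, rfl⟩
    refine Set.ext fun W => ⟨fun _ => trivial, fun _ => ?_⟩
    exact (Set.ext_iff.1 (f.eval_eq_subsets A θ) W.1).2 (W.2 f hf θ)
  · intro h
    -- Meeting with `axSubsets`, which is congruent to `⊤`, does not change the class; hence `S ~ S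
    -- ⊓ E = T ⊓ E ~ T`.
    have e : S ⊓ axSubsets Ax A = T ⊓ axSubsets Ax A := by
      refine Set.ext fun W => and_congr_left fun hW => ?_
      exact Set.ext_iff.1 h ⟨W, hW⟩
    have key : ∀ S : FreeCABA A, (axCongruence Ax A).r (S ⊓ axSubsets Ax A) S := fun S => by
      have := (axCongruence Ax A).inf ((axCongruence Ax A).iseqv.refl S)
        (axCongruence_axSubsets Ax A)
      rwa [inf_top_eq] at this
    exact (axCongruence Ax A).iseqv.trans ((axCongruence Ax A).iseqv.symm (key S)) (e ▸ key T)

/-- The complete homomorphism induced on the quotient by the restriction to `Ax`-subsets. -/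
noncomputable def quotToPowerset :
    CompleteLatticeHom (axCongruence Ax A).Quot (Set {W : Set A // IsAxSubset Ax W}) :=
  (axCongruence Ax A).lift (restrictAx Ax A) fun S T => (axCongruence_iff Ax A S T).1

theorem quotToPowerset_boxAx (a : A) :
    quotToPowerset Ax A (boxAx Ax a) = {W | a ∈ W.1} := rfl

/-- Injectivity is the description of the congruence; surjectivity holds because a set of
`Ax`-subsets is the restriction of its own image. -/
theorem quotToPowerset_bijective : Function.Bijective (quotToPowerset Ax A) := by
  constructor
  · intro x y h
    obtain ⟨S, rfl⟩ := (axCongruence Ax A).proj_surjective x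
    obtain ⟨T, rfl⟩ := (axCongruence Ax A).proj_surjective y
    exact (axCongruence Ax A).proj_eq.2 ((axCongruence_iff Ax A S T).2 h)
  · intro s
    refine ⟨(axCongruence Ax A).proj (show Set (Set A) from Subtype.val '' s), ?_⟩
    exact Set.preimage_image_eq s Subtype.val_injective

/-- The quotient of the free CABA on `A` by the axioms is the powerset of the set of
`Ax`-subsets. -/
noncomputable def quotOrderIso :
    (axCongruence Ax A).Quot ≃o Set {W : Set A // IsAxSubset Ax W} where
  toEquiv := Equiv.ofBijective _ (quotToPowerset_bijective Ax A)
  map_rel_iff' {x y} := by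
    change quotToPowerset Ax A x ≤ quotToPowerset Ax A y ↔ x ≤ y
    refine ⟨fun h => ?_, fun h => OrderHomClass.mono _ h⟩
    -- An injective map preserving binary meets reflects the order, since `x ≤ y` means `x ⊓ y = x`.
    refine inf_eq_left.1 ((quotToPowerset_bijective Ax A).1 ?_)
    exact (map_inf (quotToPowerset Ax A) x y).trans (inf_eq_left.2 h)

/-- `L_Ax ∘ ℘` is naturally isomorphic to `℘ ∘ B_Ax`. -/
noncomputable def powersetLAxIso :
    powersetFunctor ⋙ LAx Ax ≅ (BAx Ax).op ⋙ powersetFunctor :=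
  NatIso.ofComponents
    (fun X => CABA.isoOfOrderIso (A := CABA.of (axCongruence Ax (Set X.unop)).Quot)
      (B := CABA.of (Set {W : Set (Set X.unop) // IsAxSubset Ax W}))
      (quotOrderIso Ax (Set X.unop)))
    -- It suffices to compare on generators: both composites send `□ a` to the set of those `W` that
    -- contain `f⁻¹(a)`.
    (fun {_ Y} f => CABA.Hom.ext (hom_ext_boxAx Ax fun a =>
      congrArg (quotToPowerset Ax (Set Y.unop))
        (mapAx_boxAx Ax (CompleteLatticeHom.setPreimage f.unop) a)))

end Quotient

end TarskiDuality

/-! ### Algebras and coalgebras of dual endofunctors -/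

namespace CategoryTheory.Endofunctor.Coalgebra

universe v₁ v₂ u₁ u₂

variable {C : Type u₁} [Category.{v₁} C] {D : Type u₂} [Category.{v₂} D] {F : C ⥤ C} {T : D ⥤ D}
  {P : Dᵒᵖ ⥤ C} (α : P ⋙ F ≅ T.op ⋙ P)

/-- The algebra on `P X` given by a coalgebra on `X`. -/
def opToAlgebra : (Coalgebra T)ᵒᵖ ⥤ Algebra F where
  obj X := ⟨P.obj (.op X.unop.V), α.hom.app (.op X.unop.V) ≫ P.map X.unop.str.op⟩
  map {X Y} f := ⟨P.map f.unop.f.op, by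
    -- The algebra square is the naturality square of `α` pasted to the image under `P` of the
    -- coalgebra square.
    have h1 := α.hom.naturality f.unop.f.op
    have h2 := congrArg (fun g => P.map g.op) f.unop.h
    simp only [op_comp, P.map_comp, Functor.comp_map, Functor.op_map, Quiver.Hom.unop_op] at h1 h2
    rw [reassoc_of% h1, h2, Category.assoc]⟩
  map_id X := Algebra.ext (w := P.map_id _)
  map_comp f g := Algebra.ext (w := P.map_comp f.unop.f.op g.unop.f.op)

instance [P.Faithful] : (opToAlgebra α).Faithful where
  map_injective h :=
    Quiver.Hom.unop_inj (Coalgebra.ext (w := Quiver.Hom.op_inj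
      (P.map_injective (congrArg Algebra.Hom.f h))))

/-- The pasting can be undone: `α` is invertible, hence cancellable, and faithfulness of `P`
reflects the remaining square to a coalgebra square. -/
instance [P.Full] [P.Faithful] : (opToAlgebra α).Full where
  map_surjective {X Y} g := by
    obtain ⟨f, hf⟩ := P.map_surjective g.f
    refine ⟨Quiver.Hom.op ⟨f.unop, ?_⟩, Algebra.ext (w := hf)⟩
    refine Quiver.Hom.op_inj (P.map_injective ?_)
    have h1 := α.hom.naturality f
    have h2 : F.map (P.map f) ≫ α.hom.app (.op Y.unop.V) ≫ P.map Y.unop.str.op =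
        (α.hom.app (.op X.unop.V) ≫ P.map X.unop.str.op) ≫ P.map f := hf ▸ g.h
    rw [Functor.comp_map] at h1
    rw [reassoc_of% h1, Category.assoc] at h2
    have h3 := (cancel_epi (α.hom.app (.op X.unop.V))).1 h2
    rw [op_comp, op_comp, P.map_comp, P.map_comp]
    exact h3

/-- Transport the algebra structure along an isomorphism `e` from some `P Y` to the carrier,
precompose with the inverse of `α`, and use fullness of `P` to obtain a coalgebra structure on `Y`.
-/
instance [P.IsEquivalence] : (opToAlgebra α).EssSurj where
  mem_essImage B := by
    let e := P.objObjPreimageIso B.a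
    obtain ⟨s, hs⟩ := P.map_surjective
      (α.inv.app (P.objPreimage B.a) ≫ F.map e.hom ≫ B.str ≫ e.inv)
    refine ⟨.op ⟨(P.objPreimage B.a).unop, s.unop⟩, ⟨Algebra.isoMk e ?_⟩⟩
    change F.map e.hom ≫ B.str = (α.hom.app (P.objPreimage B.a) ≫ P.map s) ≫ e.hom
    simp [hs]

instance [P.IsEquivalence] : (opToAlgebra α).IsEquivalence where

/-- If the endofunctors `F` and `T` correspond under a dual equivalence, the category of
`F`-algebras is dually equivalent to the category of `T`-coalgebras. -/
noncomputable def algebraOpEquiv [P.IsEquivalence] : (Algebra F)ᵒᵖ ≌ Coalgebra T :=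
  (opToAlgebra α).asEquivalence.op.symm.trans (opOpEquivalence _)

end CategoryTheory.Endofunctor.Coalgebra

/-- The functors `L_Ax` and `B_Ax` are Tarski-duals, `at ∘ L_Ax ∘ ℘` is naturally isomorphic to
`B_Ax`, and `Alg(L_Ax)` is dually equivalent to `Coalg(B_Ax)`. -/
theorem theorem3 (S : TarskiDuality.VarSystem.{u}) (Ax : Set (TarskiDuality.OneStep S.carrier))
    (hAx : TarskiDuality.IsIncreasing S Ax) :
    TarskiDuality.TarskiDuals (TarskiDuality.LAx Ax) (TarskiDuality.BAx Ax) ∧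
    Nonempty ((TarskiDuality.powersetFunctor ⋙ TarskiDuality.LAx Ax ⋙
      TarskiDuality.atomsFunctor).unop ≅ TarskiDuality.BAx Ax) ∧
    Nonempty ((Endofunctor.Algebra (TarskiDuality.LAx Ax))ᵒᵖ ≌
      Endofunctor.Coalgebra (TarskiDuality.BAx Ax)) := by
  -- Apply `at` to `L_Ax ∘ ℘ ≅ ℘ ∘ B_Ax` and cancel `at ∘ ℘`.
  have β : TarskiDuality.powersetFunctor ⋙ TarskiDuality.LAx Ax ⋙ TarskiDuality.atomsFunctor ≅
      (TarskiDuality.BAx Ax).op :=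
    (Functor.associator _ _ _).symm ≪≫
      Functor.isoWhiskerRight (TarskiDuality.powersetLAxIso Ax) TarskiDuality.atomsFunctor ≪≫
      Functor.associator _ _ _ ≪≫
      Functor.isoWhiskerLeft _ TarskiDuality.powersetAtomsIso ≪≫ Functor.rightUnitor _
  refine ⟨⟨⟨?_⟩, ⟨TarskiDuality.powersetLAxIso Ax⟩⟩, ⟨?_⟩, ⟨?_⟩⟩
  -- Replace each CABA by the powerset of its atoms, then use `β` at the set of atoms.
  · exact (Functor.leftUnitor _).symm ≪≫
      Functor.isoWhiskerRight TarskiDuality.atomsPowersetIso.symm _ ≪≫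
      Functor.associator _ _ _ ≪≫ Functor.isoWhiskerLeft TarskiDuality.atomsFunctor β
  -- `β` lives in the opposite of the category of sets; reading it there reverses arrows, hence the
  -- inverse components.
  · exact NatIso.ofComponents (fun X => (β.app (.op X)).symm.unop) fun f =>
      Quiver.Hom.op_inj (β.inv.naturality f.op).symm
  · exact Endofunctor.Coalgebra.algebraOpEquiv (TarskiDuality.powersetLAxIso Ax)
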